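/- Let $\Sigma\subseteq\Xi$ be finite alphabets with two distinct tokens $\langle SEP\rangle,\langle EOS\rangle\in\Xi\setminus\Sigma$, and let $\mathsf 1\ne\mathsf 0$ be two answer symbols in $\Xi\setminus\{\langle SEP\rangle,\langle EOS\rangle\}$. C-RASP[pos] expressions over $\Xi$ are interpreted at the positions $i=1,\dots,|w|$ of a word $w\in\Xi^*$. Boolean expressions are $Q_\sigma(i)$ ("the $i$-th symbol is $\sigma$", for $\sigma\in\Xi$), $\neg P(i)$, $P_1(i)\wedge P_2(i)$, $\top$, $\phi(i)$ for a periodic $\phi:\mathbb N\to\{0,1\}$, and $C_1(i)\le C_2(i)$. Integer-valued count expressions are $1$, $C_1(i)\pm C_2(i)$, "if $P(i)$ then $C_1(i)$ else $C_2(i)$", $\#\{j\le i: P(j)\}$, and $\#\{j\le i:\psi(i,j)\wedge P(j)\}$ for a local relation $\psi$, that is, one with $\psi(i+1,j+1)=\psi(i,j)$ for all $i,j$ and with a constant $\tau$ such that $\psi(i,j)=0$ whenever $i-j>\tau$. For the empty word, expressions are evaluated at $i=0$, where all $Q_\sigma$ are false. A CoT program in C-RASP[pos] over $\Xi$ is a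 family $(\varphi_\sigma)_{\sigma\in\Xi}$ of Boolean expressions (the clauses $\mathrm{OUTPUT}(\sigma)\leftarrow\varphi_\sigma$) such that for every $w\in\Xi^*$ exactly one $\varphi_\sigma$ is true on $w$ at position $|w|$; this $\sigma$ is the next token $S(w)$. The program generates $U=U_1\cdots U_m$ on input $w$ if $S(wU_1\cdots U_{k-1})=U_k$ for $k=1,\dots,m$. It computes the indicator function $F_{\mathcal L}$ of a language $\mathcal L\subseteq\Sigma^*$ with CoT if on every input $w\in\Sigma^*$ it generates a string ending in $\langle SEP\rangle\,\mathsf 1\,\langle EOS\rangle$ if $w\in\mathcal L$, and in $\langle SEP\rangle\,\mathsf 0\,\langle EOS\rangle$ if $w\notin\mathcal L$, in which $\langle EOS\rangle$ occurs only as the last token. The length of the generated string is not bounded in any way. Theorem. If the indicator function of $\mathcal L\subseteq\Sigma^*$ is computed with CoT by some CoT program in C-RASP[pos], then $\mathcal L$ is in non-uniform $\mathsf{TC}^0$: there are a constant $d$ and a polynomial $p$ such that for every $n$ some circuit of depth at most $d$ with at most $p(n)$ gates decides membership in $\mathcal L$ for the words $x\in\Sigma^n$, where the gates are input tests $[x_i=a]$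 with $a\in\Sigma$, negations, and AND, OR and MAJORITY gates of unbounded fan-in. -/

import Mathlib

universe u

/-! Expressions of C-RASP with unary positional predicates from `Φ` and binary positional
relations from `Ψ`, over the alphabet `Ξ`. -/

mutual

/-- Boolean-valued C-RASP expressions. -/
inductive BoolExpr (Ξ : Type u) (Φ : Set (ℕ → Prop)) (Ψ : Set (ℕ → ℕ → Prop)) : Type u
  | sym (σ : Ξ) : BoolExpr Ξ Φ Ψ
  | not (P : BoolExpr Ξ Φ Ψ) : BoolExpr Ξ Φ Ψ
  | and (P₁ P₂ : BoolExpr Ξ Φ Ψ) : BoolExpr Ξ Φ Ψ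
  | pos (φ : ℕ → Prop) (hφ : φ ∈ Φ) : BoolExpr Ξ Φ Ψ
  | top : BoolExpr Ξ Φ Ψ
  | le (C₁ C₂ : CountExpr Ξ Φ Ψ) : BoolExpr Ξ Φ Ψ

/-- Count-valued C-RASP expressions. -/
inductive CountExpr (Ξ : Type u) (Φ : Set (ℕ → Prop)) (Ψ : Set (ℕ → ℕ → Prop)) : Type u
  | count (P : BoolExpr Ξ Φ Ψ) : CountExpr Ξ Φ Ψ
  | countRel (ψ : ℕ → ℕ → Prop) (hψ : ψ ∈ Ψ) (P : BoolExpr Ξ Φ Ψ) : CountExpr Ξ Φ Ψ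
  | cond (P : BoolExpr Ξ Φ Ψ) (C₁ C₂ : CountExpr Ξ Φ Ψ) : CountExpr Ξ Φ Ψ
  | add (C₁ C₂ : CountExpr Ξ Φ Ψ) : CountExpr Ξ Φ Ψ
  | sub (C₁ C₂ : CountExpr Ξ Φ Ψ) : CountExpr Ξ Φ Ψ
  | one : CountExpr Ξ Φ Ψ

end

section Semantics

variable {Ξ : Type u} {Φ : Set (ℕ → Prop)} {Ψ : Set (ℕ → ℕ → Prop)}

open Classical in
mutual

/-- Truth value of a Boolean expression at position `i` of `w`. The positions of `w` are
`1, …, |w|`; position `0` carries no symbol. -/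
noncomputable def BoolExpr.eval (w : List Ξ) : BoolExpr Ξ Φ Ψ → ℕ → Prop
  | .sym σ, i => 1 ≤ i ∧ w[i - 1]? = some σ
  | .not P, i => ¬ P.eval w i
  | .and P₁ P₂, i => P₁.eval w i ∧ P₂.eval w i
  | .pos φ _, i => φ i
  | .top, _ => True
  | .le C₁ C₂, i => C₁.eval w i ≤ C₂.eval w i

/-- Value of a count expression at position `i` of `w`. -/
noncomputable def CountExpr.eval (w : List Ξ) : CountExpr Ξ Φ Ψ → ℕ → ℤ
  | .count P, i => ({j ∈ Finset.Icc 1 i | P.eval w j}.card : ℤ)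
  | .countRel ψ _ P, i => ({j ∈ Finset.Icc 1 i | ψ i j ∧ P.eval w j}.card : ℤ)
  | .cond P C₁ C₂, i => if P.eval w i then C₁.eval w i else C₂.eval w i
  | .add C₁ C₂, i => C₁.eval w i + C₂.eval w i
  | .sub C₁ C₂, i => C₁.eval w i - C₂.eval w i
  | .one, _ => 1

end

end Semantics

/-- The periodic unary predicates. -/
def periodicPreds : Set (ℕ → Prop) :=
  {φ | ∃ p : ℕ, 0 < p ∧ ∀ i, φ (i + p) ↔ φ i}

/-- The local binary relations: translation invariant, and false whenever position `j` lies
more than a fixed distance before position `i`. -/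
def localRels : Set (ℕ → ℕ → Prop) :=
  {ψ | (∀ i j, ψ (i + 1) (j + 1) ↔ ψ i j) ∧ ∃ τ : ℕ, ∀ i j, ψ i j → i ≤ j + τ}

/-- A CoT program in C-RASP[pos] with token alphabet `Ξ`: one output clause per token, exactly
one of which is true at the last position of every prefix. -/
structure CoTProgram (Ξ : Type u) where
  /-- The Boolean expression of the clause `OUTPUT(σ)`. -/
  out : Ξ → BoolExpr Ξ periodicPreds localRels
  exactly_one : ∀ w : List Ξ, ∃! σ : Ξ, (out σ).eval w w.length

/-- The next-token map of a CoT program: the `σ` whose output clause is true at the last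
position. -/
noncomputable def CoTProgram.nextToken {Ξ : Type u} (P : CoTProgram Ξ) (w : List Ξ) : Ξ :=
  (P.exactly_one w).choose

/-- `M` generates `U` on the prefix `w`. -/
def Generates {Ξ : Type u} (M : List Ξ → Ξ) (w U : List Ξ) : Prop :=
  ∀ (k : ℕ) (hk : k < U.length), M (w ++ U.take k) = U[k]

/-- An inclusion of the input alphabet `α` in the token alphabet `Ξ`, with two further tokens:
the separator before the final answer and the end-of-sequence token. -/
structure CoTAlphabet (α : Type*) (Ξ : Type*) where
  emb : α ↪ Ξ
  sep : Ξ
  eos : Ξ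
  sep_ne_eos : sep ≠ eos
  sep_notMem : sep ∉ Set.range emb
  eos_notMem : eos ∉ Set.range emb

/-- `M` computes the partial function `F` with CoT. Generation ends at the first
end-of-sequence token: if `F w = v` is defined, `M` generates a string `T ⟨SEP⟩ v ⟨EOS⟩` with
no earlier `⟨EOS⟩`; if `F w` is undefined, `M` never generates `⟨EOS⟩`. -/
def ComputesWithCoT {α Ξ : Type*} (A : CoTAlphabet α Ξ) (M : List Ξ → Ξ)
    (F : List α → Option (List Ξ)) : Prop :=
  ∀ w : List α,
    (∀ v, F w = some v →
      ∃ T : List Ξ, A.eos ∉ T ++ [A.sep] ++ v ∧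
        Generates M (w.map A.emb) (T ++ [A.sep] ++ v ++ [A.eos])) ∧
    (F w = none → ∀ U, Generates M (w.map A.emb) U → A.eos ∉ U)

open Classical in
/-- The indicator function of `L`, with its two values written as the one-letter words `one`
and `zero`. -/
noncomputable def indicatorFun {α Ξ : Type*} (L : Language α) (one zero : Ξ) :
    List α → Option (List Ξ) :=
  fun w => some (if w ∈ L then [one] else [zero])

/-! Threshold circuits and non-uniform TC⁰. -/

/-- A gate of a circuit with `n` inputs from `α` and gate set `G`: a test whether the `i`-th
letter is `a`, a negation, or an unbounded fan-in AND, OR or MAJORITY of gates. -/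
inductive Gate (α : Type u) (n : ℕ) (G : Type) : Type u
  | input (i : Fin n) (a : α) : Gate α n G
  | not (g : G) : Gate α n G
  | and (s : Finset G) : Gate α n G
  | or (s : Finset G) : Gate α n G
  | maj (s : Finset G) : Gate α n G

/-- The gates that are wired into a gate. -/
def Gate.preds {α : Type u} {n : ℕ} {G : Type} : Gate α n G → Finset G
  | .input _ _ => ∅
  | .not g => {g}
  | .and s => s
  | .or s => s
  | .maj s => s

/-- A circuit with `n` inputs from `α`. The function `level` increases strictly along every
wire: the wiring is acyclic, and `level g` bounds the length of every path that ends in `g`. -/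
structure Circuit (α : Type u) (n : ℕ) where
  G : Type
  [fintypeG : Fintype G]
  gate : G → Gate α n G
  level : G → ℕ
  level_lt : ∀ g, ∀ h ∈ (gate g).preds, level h < level g
  output : G

namespace Circuit

variable {α : Type u} {n : ℕ}

/-- Size: the number of gates. -/
def size (C : Circuit α n) : ℕ := @Fintype.card C.G C.fintypeG

open Classical in
/-- The value of gate `g` on the input word `x`. A MAJORITY gate is true when at least half of
its inputs are. -/
def value (C : Circuit α n) (x : Fin n → α) (g : C.G) : Prop :=
  match _hg : C.gate g with
  | .input i a => x i = a
  | .not h => ¬ value C x h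
  | .and s => ∀ h : {h // h ∈ s}, value C x h.1
  | .or s => ∃ h : {h // h ∈ s}, value C x h.1
  | .maj s => s.card ≤ 2 * {h ∈ s.attach | value C x h.1}.card
termination_by C.level g
decreasing_by
  all_goals apply C.level_lt; rw [_hg]; simp [Gate.preds]

end Circuit

/-- `L` is in non-uniform TC⁰: it is decided by a family of circuits of constant depth and
polynomial size, one for each input length. -/
def InTC0 {α : Type u} (L : Language α) : Prop :=
  ∃ (d : ℕ) (p : Polynomial ℕ), ∀ n : ℕ, ∃ C : Circuit α n,
    (∀ g, C.level g ≤ d) ∧ C.size ≤ p.eval n ∧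
    ∀ x : Fin n → α, C.value x C.output ↔ List.ofFn x ∈ L

namespace Gate

variable {α : Type u} {n : ℕ} {G H : Type}

open Classical in
/-- The value of a gate on the input word `x` when the gates wired into it have the values `v`. -/
def eval (x : Fin n → α) (v : G → Prop) : Gate α n G → Prop
  | .input i a => x i = a
  | .not g => ¬ v g
  | .and s => ∀ g ∈ s, v g
  | .or s => ∃ g ∈ s, v g
  | .maj s => s.card ≤ 2 * {g ∈ s | v g}.card

/-- Renaming of the gates wired into a gate. -/
def map (e : G ↪ H) : Gate α n G → Gate α n H
  | .input i a => .input i a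
  | .not g => .not (e g)
  | .and s => .and (s.map e)
  | .or s => .or (s.map e)
  | .maj s => .maj (s.map e)

theorem preds_map (e : G ↪ H) (g : Gate α n G) : (g.map e).preds = g.preds.map e := by
  cases g <;> simp [map, preds]

theorem eval_map (e : G ↪ H) (g : Gate α n G) (x : Fin n → α) (v : H → Prop) :
    (g.map e).eval x v ↔ g.eval x (v ∘ e) := by
  classical
  cases g <;> simp [map, eval, Finset.filter_map]

theorem eval_congr (g : Gate α n G) (x : Fin n → α) {v w : G → Prop}
    (h : ∀ k ∈ g.preds, (v k ↔ w k)) : g.eval x v ↔ g.eval x w := by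
  classical
  cases g with
  | input i a => rfl
  | not k => simp [eval, h k (by simp [preds])]
  | and s => exact forall₂_congr h
  | or s => exact exists_congr fun k => and_congr_right (h k)
  | maj s => simp only [eval, Finset.filter_congr (s := s) h]

end Gate

namespace Circuit

variable {α : Type u} {n : ℕ}

theorem value_iff (C : Circuit α n) (x : Fin n → α) (g : C.G) :
    C.value x g ↔ (C.gate g).eval x (C.value x) := by
  classical
  rw [Circuit.value]
  split <;> rename_i h <;> rw [h] <;> simp only [Gate.eval, Subtype.forall, Subtype.exists,
    exists_prop]
  rename_i s
  rw [Finset.card_filter, Finset.card_filter, ← Finset.sum_attach s]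

/-- A gate on top of the outputs of a family of circuits. -/
def combine {ι : Type} [Fintype ι] (C : ι → Circuit α n) (top : Gate α n ι) (d : ℕ)
    (hd : ∀ i g, (C i).level g ≤ d) : Circuit α n where
  G := Option (Σ i, (C i).G)
  fintypeG := haveI := fun i => (C i).fintypeG; inferInstance
  gate
    | none => top.map ⟨fun i => some ⟨i, (C i).output⟩, fun i j h => by
        simpa using (congrArg (Option.map Sigma.fst) h)⟩
    | some ⟨i, g⟩ => ((C i).gate g).map ((Function.Embedding.sigmaMk i).trans .some)
  level
    | none => d + 1
    | some ⟨i, g⟩ => (C i).level g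
  level_lt := by
    rintro (_ | ⟨i, g⟩) h hh
    · simp only [Gate.preds_map, Finset.mem_map] at hh
      obtain ⟨i, -, rfl⟩ := hh
      exact Nat.lt_succ_of_le (hd _ _)
    · simp only [Gate.preds_map, Finset.mem_map] at hh
      obtain ⟨k, hk, rfl⟩ := hh
      exact (C i).level_lt g k hk
  output := none

section combine

variable {ι : Type} [Fintype ι] (C : ι → Circuit α n) (top : Gate α n ι) (d : ℕ)
  (hd : ∀ i g, (C i).level g ≤ d)

theorem value_combine_some (x : Fin n → α) (i : ι) (g : (C i).G) :
    (combine C top d hd).value x (some ⟨i, g⟩) ↔ (C i).value x g := by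
  induction hl : (C i).level g using Nat.strong_induction_on generalizing g with
  | _ l ih =>
    refine (value_iff _ _ _).trans (.trans ?_ (value_iff _ _ _).symm)
    refine (Gate.eval_map _ _ _ _).trans (Gate.eval_congr _ _ fun k hk => ?_)
    exact ih _ (hl ▸ (C i).level_lt g k hk) k rfl

theorem value_combine_output (x : Fin n → α) :
    (combine C top d hd).value x (combine C top d hd).output ↔
      top.eval x fun i => (C i).value x (C i).output := by
  rw [value_iff]
  refine (Gate.eval_map _ _ _ _).trans (Gate.eval_congr _ _ fun k _ => ?_)
  exact value_combine_some C top d hd x k _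

theorem size_combine : (combine C top d hd).size = ∑ i, (C i).size + 1 := by
  let := fun i => (C i).fintypeG
  change Fintype.card (Option (Σ i, (C i).G)) = _
  rw [Fintype.card_option, Fintype.card_sigma]
  rfl

end combine

end Circuit

/-- `f` is decided by a circuit of depth at most `d` with at most `s` gates. -/
def HasCircuit {α : Type u} {n : ℕ} (d s : ℕ) (f : (Fin n → α) → Prop) : Prop :=
  ∃ C : Circuit α n, (∀ g, C.level g ≤ d) ∧ C.size ≤ s ∧ ∀ x, C.value x C.output ↔ f x

namespace HasCircuit

variable {α : Type u} {n d s : ℕ}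

theorem mono {d' s' : ℕ} {f : (Fin n → α) → Prop} (h : HasCircuit d s f) (hd : d ≤ d')
    (hs : s ≤ s') : HasCircuit d' s' f :=
  let ⟨C, h1, h2, h3⟩ := h
  ⟨C, fun g => (h1 g).trans hd, h2.trans hs, h3⟩

theorem congr {f g : (Fin n → α) → Prop} (h : HasCircuit d s f) (hfg : ∀ x, f x ↔ g x) :
    HasCircuit d s g :=
  let ⟨C, h1, h2, h3⟩ := h
  ⟨C, h1, h2, fun x => (h3 x).trans (hfg x)⟩

theorem gate {ι : Type} [Fintype ι] {f : ι → (Fin n → α) → Prop} (top : Gate α n ι)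
    (h : ∀ i, HasCircuit d s (f i)) :
    HasCircuit (d + 1) (Fintype.card ι * s + 1) fun x => top.eval x fun i => f i x := by
  choose C h1 h2 h3 using h
  refine ⟨Circuit.combine C top d h1, ?_, ?_, fun x => ?_⟩
  · rintro (_ | ⟨i, g⟩)
    · exact le_rfl
    · exact (h1 i g).trans (Nat.le_succ d)
  · rw [Circuit.size_combine]
    have := Finset.sum_le_card_nsmul Finset.univ (fun i => (C i).size) s fun i _ => h2 i
    simpa using this
  · rw [Circuit.value_combine_output]
    exact Gate.eval_congr _ _ fun i _ => h3 i x

theorem input (i : Fin n) (a : α) : HasCircuit 1 1 fun x : Fin n → α => x i = a := by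
  simpa [Gate.eval] using
    gate (d := 0) (s := 0) (ι := Empty) (f := fun e _ => e.elim) (.input i a) (by simp)

theorem const (b : Prop) : HasCircuit 1 1 fun _ : Fin n → α => b := by
  by_cases hb : b
  · simpa [Gate.eval, hb] using
      gate (d := 0) (s := 0) (ι := Empty) (f := fun e (_ : Fin n → α) => e.elim) (.and ∅) (by simp)
  · simpa [Gate.eval, hb] using
      gate (d := 0) (s := 0) (ι := Empty) (f := fun e (_ : Fin n → α) => e.elim) (.or ∅) (by simp)

theorem not {f : (Fin n → α) → Prop} (h : HasCircuit d s f) :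
    HasCircuit (d + 1) (s + 1) fun x => ¬ f x := by
  simpa [Gate.eval] using gate (ι := Unit) (f := fun _ => f) (.not ()) fun _ => h

theorem all {K : Type*} [Finite K] {f : K → (Fin n → α) → Prop} (h : ∀ k, HasCircuit d s (f k)) :
    HasCircuit (d + 1) (Nat.card K * s + 1) fun x => ∀ k, f k x := by
  have e := (Finite.equivFin K).symm
  have := gate (.and Finset.univ) fun k => h (e k)
  rw [Fintype.card_fin] at this
  exact this.congr fun x => by simp [Gate.eval, e.forall_congr_left, Equiv.apply_symm_apply]

theorem exists_mem {K : Type*} (S : Finset K) {f : K → (Fin n → α) → Prop}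
    (h : ∀ k ∈ S, HasCircuit d s (f k)) :
    HasCircuit (d + 1) (S.card * s + 1) fun x => ∃ k ∈ S, f k x := by
  have e := S.equivFin.symm
  have := gate (.or Finset.univ) fun k => h (e k) (e k).2
  rw [Fintype.card_fin] at this
  refine this.congr fun x => ?_
  simp only [Gate.eval, Finset.mem_univ, true_and]
  exact ⟨fun ⟨k, hk⟩ => ⟨_, (e k).2, hk⟩, fun ⟨k, hk, hf⟩ => ⟨e.symm ⟨k, hk⟩, by simpa using hf⟩⟩

theorem and {f g : (Fin n → α) → Prop} (hf : HasCircuit d s f) (hg : HasCircuit d s g) :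
    HasCircuit (d + 1) (2 * s + 1) fun x => f x ∧ g x := by
  have := all (d := d) (s := s) (K := Bool) (f := fun b => bif b then f else g) (by simp [hf, hg])
  rw [Nat.card_eq_fintype_card, Fintype.card_bool] at this
  exact this.congr fun x => by simp [and_comm]

open Classical in
theorem threshold {T : Finset ℕ} {f : ℕ → (Fin n → α) → Prop} (k : ℕ)
    (h : ∀ j ∈ T, HasCircuit d s (f j)) :
    HasCircuit (d + 2) ((T.card + (T.card + 2 * k)) * (s + 1) + 1)
      fun x => k ≤ {j ∈ T | f j x}.card := by
  let F : T ⊕ (T ⊕ Fin (2 * k)) → (Fin n → α) → Prop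
    | .inl j => f j
    | .inr (.inl _) => fun _ => True
    | .inr (.inr _) => fun _ => False
  have hF : ∀ i, HasCircuit (d + 1) (s + 1) (F i) := by
    rintro (j | _ | _)
    · exact (h j j.2).mono (by omega) (by omega)
    · exact (const True).mono (by omega) (by omega)
    · exact (const False).mono (by omega) (by omega)
  have := gate (.maj Finset.univ) hF
  simp only [Fintype.card_sum, Fintype.card_coe, Fintype.card_fin] at this
  refine this.congr fun x => ?_
  have key : (Finset.univ.filter fun i => F i x).card = {j ∈ T | f j x}.card + T.card := by
    simp only [Finset.card_filter, Fintype.sum_sum_type, F, if_true, if_false, Finset.sum_const,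
      Finset.card_univ, Fintype.card_coe, smul_eq_mul, mul_one, mul_zero, add_zero]
    rw [Finset.sum_coe_sort T fun j => if f j x then 1 else 0]
  simp only [Gate.eval]
  rw [key]
  simp only [Finset.card_univ, Fintype.card_sum, Fintype.card_coe, Fintype.card_fin]
  omega

end HasCircuit

/-- `f` takes at most `s` values, and each of its fibres is decided by a circuit of depth at most
`d` with at most `s` gates. -/
def Classified {α : Type u} {n : ℕ} {β : Type*} (d s : ℕ) (f : (Fin n → α) → β) : Prop :=
  ∃ S : Finset β, S.card ≤ s ∧ (∀ x, f x ∈ S) ∧ ∀ b, HasCircuit d s fun x => f x = b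

namespace Classified

variable {α : Type u} {n d s : ℕ} {β γ : Type*}

theorem mono {d' s' : ℕ} {f : (Fin n → α) → β} (h : Classified d s f) (hd : d ≤ d')
    (hs : s ≤ s') : Classified d' s' f :=
  let ⟨S, h1, h2, h3⟩ := h
  ⟨S, h1.trans hs, h2, fun b => (h3 b).mono hd hs⟩

theorem const (b : β) : Classified 1 1 fun _ : Fin n → α => b :=
  ⟨{b}, by simp, by simp, fun _ => .const _⟩

theorem of_hasCircuit {f : (Fin n → α) → Prop} (h : HasCircuit d s f) :
    Classified (d + 1) (s + 2) f := by
  classical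
  refine ⟨{True, False}, Finset.card_le_two.trans (by omega), fun x => ?_, fun b => ?_⟩
  · by_cases hx : f x <;> simp [hx]
  · by_cases hb : b
    · exact (h.mono (by omega) (by omega)).congr fun x => by simp [hb]
    · exact (h.not.mono (by omega) (by omega)).congr fun x => by simp [hb]

theorem hasCircuit {f : (Fin n → α) → Prop} (h : Classified d s f) : HasCircuit d s f :=
  let ⟨_, _, _, h3⟩ := h
  (h3 True).congr fun x => by simp

theorem map {f : (Fin n → α) → β} (h : Classified d s f) (g : β → γ) :
    Classified (d + 1) (s * s + s + 1) fun x => g (f x) := by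
  classical
  obtain ⟨S, h1, h2, h3⟩ := h
  refine ⟨S.image g, Finset.card_image_le.trans (h1.trans (by nlinarith)),
    fun x => Finset.mem_image_of_mem g (h2 x), fun c => ?_⟩
  have hS : (S.filter fun b => g b = c).card ≤ s := (Finset.card_filter_le _ _).trans h1
  refine ((HasCircuit.exists_mem (S.filter fun b => g b = c) fun b _ => h3 b).mono le_rfl
    ?_).congr fun x => ?_
  · nlinarith
  · constructor
    · rintro ⟨b, hb, rfl⟩
      exact (Finset.mem_filter.1 hb).2
    · exact fun hx => ⟨f x, Finset.mem_filter.2 ⟨h2 x, hx⟩, rfl⟩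

theorem prodMk {f : (Fin n → α) → β} {g : (Fin n → α) → γ} (hf : Classified d s f)
    (hg : Classified d s g) : Classified (d + 1) (s * s + 2 * s + 1) fun x => (f x, g x) := by
  obtain ⟨S, h1, h2, h3⟩ := hf
  obtain ⟨T, k1, k2, k3⟩ := hg
  refine ⟨S ×ˢ T, ?_, fun x => Finset.mk_mem_product (h2 x) (k2 x), fun c => ?_⟩
  · rw [Finset.card_product]
    nlinarith [Nat.mul_le_mul h1 k1]
  · exact (((h3 c.1).and (k3 c.2)).mono le_rfl (by omega)).congr fun x =>
      (Prod.ext_iff (x := (f x, g x))).symm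

theorem pi {K : Type*} [Finite K] {f : K → (Fin n → α) → β} (h : ∀ k, Classified d s (f k)) :
    Classified (d + 1) (s ^ Nat.card K + Nat.card K * s + 1) fun x k => f k x := by
  classical
  have := Fintype.ofFinite K
  choose S h1 h2 h3 using h
  refine ⟨Fintype.piFinset S, ?_, fun x => Fintype.mem_piFinset.2 fun k => h2 k x, fun c => ?_⟩
  · rw [Fintype.card_piFinset, Nat.card_eq_fintype_card]
    have := Finset.prod_le_prod' (s := Finset.univ) fun k _ => h1 k
    simp only [Finset.prod_const, Finset.card_univ] at this
    omega
  · exact ((HasCircuit.all fun k => h3 k (c k)).mono le_rfl (by omega)).congr fun x =>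
      funext_iff.symm

open Classical in
theorem count {T : Finset ℕ} {f : ℕ → (Fin n → α) → Prop} (h : ∀ j ∈ T, HasCircuit d s (f j))
    {m : ℕ} (hm : T.card ≤ m) :
    Classified (d + 4) (2 * ((4 * m + 2) * (s + 1) + 2) + 1)
      fun x => ({j ∈ T | f j x}.card : ℤ) := by
  have hle : ∀ x, {j ∈ T | f j x}.card ≤ m := fun x => (Finset.card_filter_le _ _).trans hm
  refine ⟨(Finset.range (m + 1)).image Nat.cast, ?_, fun x => ?_, fun b => ?_⟩
  · refine Finset.card_image_le.trans ?_
    rw [Finset.card_range]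
    nlinarith
  · exact Finset.mem_image_of_mem _ (Finset.mem_range_succ_iff.2 (hle x))
  · by_cases hb : ∃ k ≤ m, (k : ℤ) = b
    · obtain ⟨k, hk, rfl⟩ := hb
      have size : ∀ l ≤ m + 1, (T.card + (T.card + 2 * l)) * (s + 1) + 1 ≤
          (4 * m + 2) * (s + 1) + 1 := fun l hl =>
        Nat.succ_le_succ (Nat.mul_le_mul_right _ (by omega))
      refine ((((HasCircuit.threshold k h).mono (Nat.le_succ _)
        ((size k (by omega)).trans (Nat.le_succ _))).and
        ((HasCircuit.threshold (k + 1) h).not.mono le_rfl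
          (Nat.succ_le_succ (size (k + 1) (by omega))))).mono le_rfl le_rfl).congr fun x => ?_
      rw [Nat.cast_inj]
      omega
    · exact ((HasCircuit.const False).mono (by omega) (by omega)).congr fun x =>
        ⟨False.elim, fun hx => hb ⟨_, hle x, hx⟩⟩

end Classified

/-- The functions `f n i` with `i ≤ n` are classified by circuits of constant depth and
polynomial size. -/
def TC0Map {α : Type u} {β : Type*} (f : ∀ n : ℕ, ℕ → (Fin n → α) → β) : Prop :=
  ∃ (d : ℕ) (p : Polynomial ℕ), ∀ n, ∀ i ≤ n, Classified d (p.eval n) (f n i)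

namespace TC0Map

variable {α : Type u} {β γ : Type*}

theorem const (b : β) : TC0Map fun n _ (_ : Fin n → α) => b :=
  ⟨1, 1, fun n _ _ => by simpa using Classified.const b⟩

theorem map {f : ∀ n : ℕ, ℕ → (Fin n → α) → β} (hf : TC0Map f) (g : ℕ → ℕ → β → γ) :
    TC0Map fun n i x => g n i (f n i x) := by
  obtain ⟨d, p, h⟩ := hf
  exact ⟨d + 1, p * p + p + 1, fun n i hi => by simpa using (h n i hi).map (g n i)⟩

theorem prodMk {f : ∀ n : ℕ, ℕ → (Fin n → α) → β} {g : ∀ n : ℕ, ℕ → (Fin n → α) → γ}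
    (hf : TC0Map f) (hg : TC0Map g) : TC0Map fun n i x => (f n i x, g n i x) := by
  obtain ⟨d, p, h⟩ := hf
  obtain ⟨e, q, k⟩ := hg
  refine ⟨max d e + 1, (p + q) * (p + q) + 2 * (p + q) + 1, fun n i hi => ?_⟩
  simpa using ((h n i hi).mono (le_max_left d e) (Nat.le_add_right _ (q.eval n))).prodMk
    ((k n i hi).mono (le_max_right d e) (Nat.le_add_left _ (p.eval n)))

theorem pi {K : Type*} [Finite K] {f : K → ∀ n : ℕ, ℕ → (Fin n → α) → β}
    (hf : ∀ k, TC0Map (f k)) : TC0Map fun n i x k => f k n i x := by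
  have := Fintype.ofFinite K
  choose d p h using hf
  refine ⟨∑ k, d k + 1, (∑ k, p k) ^ Nat.card K + Nat.card K * (∑ k, p k) + 1,
    fun n i hi => ?_⟩
  have := Classified.pi fun k => (h k n i hi).mono
    (Finset.single_le_sum (f := d) (fun _ _ => Nat.zero_le _) (Finset.mem_univ k))
    (Finset.single_le_sum (f := fun k => (p k).eval n) (fun _ _ => Nat.zero_le _)
      (Finset.mem_univ k))
  simpa [Polynomial.eval_finsetSum] using this

theorem reindex {f : ∀ n : ℕ, ℕ → (Fin n → α) → β} (hf : TC0Map f) (r : ℕ → ℕ → ℕ)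
    (hr : ∀ n i, r n i ≤ n) : TC0Map fun n i x => f n (r n i) x :=
  let ⟨d, p, h⟩ := hf
  ⟨d, p, fun n i _ => h n _ (hr n i)⟩

open Classical in
theorem count {f : ∀ n : ℕ, ℕ → (Fin n → α) → Prop} (hf : TC0Map f) (T : ℕ → Finset ℕ)
    (hT : ∀ i, T i ⊆ Finset.Icc 1 i) :
    TC0Map fun n i x => ({j ∈ T i | f n j x}.card : ℤ) := by
  obtain ⟨d, p, h⟩ := hf
  refine ⟨d + 4, 2 * ((4 * Polynomial.X + 2) * (p + 1) + 2) + 1, fun n i hi => ?_⟩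
  have hT' : (T i).card ≤ n := (Finset.card_le_card (hT i)).trans (by simpa using hi)
  simpa using Classified.count (fun j hj =>
    (h n j ((Finset.mem_Icc.1 (hT i hj)).2.trans hi)).hasCircuit) hT'

end TC0Map

/-- Words on which some function classified by circuits of constant depth and polynomial size
agrees are related by `R`. -/
def HasTC0Invariant {α : Type u} (R : ∀ n : ℕ, (Fin n → α) → (Fin n → α) → Prop) : Prop :=
  ∃ (β : Type) (f : ∀ n : ℕ, ℕ → (Fin n → α) → β), TC0Map f ∧
    ∀ n x y, f n n x = f n n y → R n x y

namespace HasTC0Invariant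

variable {α : Type u} {R R' : ∀ n : ℕ, (Fin n → α) → (Fin n → α) → Prop}

theorem of_tc0Map {β : Type} {f : ∀ n : ℕ, ℕ → (Fin n → α) → β} (hf : TC0Map f) :
    HasTC0Invariant fun n x y => f n n x = f n n y :=
  ⟨β, f, hf, fun _ _ _ h => h⟩

theorem mono (h : HasTC0Invariant R) (hR : ∀ n x y, R n x y → R' n x y) : HasTC0Invariant R' :=
  let ⟨β, f, hf, hfR⟩ := h
  ⟨β, f, hf, fun n x y hxy => hR n x y (hfR n x y hxy)⟩

theorem of_forall (h : ∀ n x y, R n x y) : HasTC0Invariant R :=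
  ⟨Unit, _, .const (), fun n x y _ => h n x y⟩

theorem and (h : HasTC0Invariant R) (h' : HasTC0Invariant R') :
    HasTC0Invariant fun n x y => R n x y ∧ R' n x y :=
  let ⟨_, _, hf, hfR⟩ := h
  let ⟨_, _, hg, hgR⟩ := h'
  ⟨_, _, hf.prodMk hg, fun n x y hxy =>
    ⟨hfR n x y (congrArg Prod.fst hxy), hgR n x y (congrArg Prod.snd hxy)⟩⟩

theorem all {m : ℕ} {R : Fin m → ∀ n : ℕ, (Fin n → α) → (Fin n → α) → Prop}
    (h : ∀ k, HasTC0Invariant (R k)) : HasTC0Invariant fun n x y => ∀ k, R k n x y := by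
  induction m with
  | zero => exact of_forall fun _ _ _ k => k.elim0
  | succ m ih =>
    exact ((h 0).and (ih fun k => h k.succ)).mono fun n x y hxy => Fin.cases hxy.1 hxy.2

theorem all_finite {K : Type*} [Finite K]
    {R : K → ∀ n : ℕ, (Fin n → α) → (Fin n → α) → Prop}
    (h : ∀ k, HasTC0Invariant (R k)) : HasTC0Invariant fun n x y => ∀ k, R k n x y :=
  (all fun k => h ((Finite.equivFin K).symm k)).mono fun n x y hxy k => by
    simpa using hxy (Finite.equivFin K k)

/-- A language is in non-uniform TC⁰ if membership depends only on an invariant of the word that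
is computed in TC⁰. -/
theorem inTC0 {L : Language α}
    (h : HasTC0Invariant fun n (x y : Fin n → α) => List.ofFn x ∈ L → List.ofFn y ∈ L) :
    InTC0 L := by
  obtain ⟨β, f, hf, hfL⟩ := h
  obtain ⟨d, p, hdp⟩ := hf.map fun n _ b => ∃ x : Fin n → α, f n n x = b ∧ List.ofFn x ∈ L
  refine ⟨d, p, fun n => ?_⟩
  refine (hdp n n le_rfl).hasCircuit.congr fun x => ?_
  exact ⟨fun ⟨y, hy, hL⟩ => hfL n y x hy hL, fun hL => ⟨x, rfl, hL⟩⟩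

end HasTC0Invariant

section Append

variable {Ξ : Type u} {Φ : Set (ℕ → Prop)} {Ψ : Set (ℕ → ℕ → Prop)}

mutual

theorem BoolExpr.eval_append (w U : List Ξ) : ∀ (P : BoolExpr Ξ Φ Ψ) {i : ℕ}, i ≤ w.length →
    (P.eval (w ++ U) i ↔ P.eval w i)
  | .sym σ, i, hi => by
    simp only [BoolExpr.eval]
    refine and_congr_right fun h => ?_
    rw [List.getElem?_append_left (by omega)]
  | .not P, i, hi => by
    simp only [BoolExpr.eval, P.eval_append w U hi]
  | .and P₁ P₂, i, hi => by
    simp only [BoolExpr.eval, P₁.eval_append w U hi, P₂.eval_append w U hi]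
  | .pos φ _, i, hi => by simp only [BoolExpr.eval]
  | .top, i, hi => by simp only [BoolExpr.eval]
  | .le C₁ C₂, i, hi => by
    simp only [BoolExpr.eval, C₁.eval_append w U hi, C₂.eval_append w U hi]

theorem CountExpr.eval_append (w U : List Ξ) : ∀ (C : CountExpr Ξ Φ Ψ) {i : ℕ}, i ≤ w.length →
    C.eval (w ++ U) i = C.eval w i
  | .count P, i, hi => by
    classical
    simp only [CountExpr.eval]
    congr 2
    exact Finset.filter_congr fun j hj => P.eval_append w U ((Finset.mem_Icc.1 hj).2.trans hi)
  | .countRel ψ _ P, i, hi => by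
    classical
    simp only [CountExpr.eval]
    congr 2
    exact Finset.filter_congr fun j hj =>
      and_congr_right fun _ => P.eval_append w U ((Finset.mem_Icc.1 hj).2.trans hi)
  | .cond P C₁ C₂, i, hi => by
    simp only [CountExpr.eval, C₁.eval_append w U hi, C₂.eval_append w U hi]
    classical
    exact if_congr (P.eval_append w U hi) rfl rfl
  | .add C₁ C₂, i, hi => by
    simp only [CountExpr.eval, C₁.eval_append w U hi, C₂.eval_append w U hi]
  | .sub C₁ C₂, i, hi => by
    simp only [CountExpr.eval, C₁.eval_append w U hi, C₂.eval_append w U hi]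
  | .one, i, hi => by simp only [CountExpr.eval]

end

end Append

section Circuits

variable {α Ξ : Type*} {Φ : Set (ℕ → Prop)} {Ψ : Set (ℕ → ℕ → Prop)}

/-- The input word over `Ξ` given by the letters `x` over the input alphabet. -/
def inputWord (e : α ↪ Ξ) {n : ℕ} (x : Fin n → α) : List Ξ := (List.ofFn x).map e

@[simp]
theorem length_inputWord (e : α ↪ Ξ) {n : ℕ} (x : Fin n → α) : (inputWord e x).length = n := by
  simp [inputWord]

theorem tc0Map_sym (e : α ↪ Ξ) (σ : Ξ) :
    TC0Map fun n i (x : Fin n → α) => 1 ≤ i ∧ (inputWord e x)[i - 1]? = some σ := by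
  refine ⟨2, 3, fun n i hi => ?_⟩
  have : HasCircuit 1 1 fun x : Fin n → α => 1 ≤ i ∧ (inputWord e x)[i - 1]? = some σ := by
    by_cases h : 1 ≤ i ∧ ∃ a, e a = σ
    · obtain ⟨h1, a, rfl⟩ := h
      have hn : i - 1 < n := by omega
      refine (HasCircuit.input ⟨i - 1, hn⟩ a).congr fun x => ?_
      simp [inputWord, h1, hn]
    · refine (HasCircuit.const False).congr fun x => ⟨False.elim, fun ⟨h1, hx⟩ => h ⟨h1, ?_⟩⟩
      have := List.mem_of_getElem? hx
      obtain ⟨a, -, ha⟩ := List.mem_map.1 this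
      exact ⟨a, ha⟩
  simpa using Classified.of_hasCircuit this

mutual

theorem BoolExpr.tc0Map_eval (e : α ↪ Ξ) : ∀ P : BoolExpr Ξ Φ Ψ,
    TC0Map fun n i (x : Fin n → α) => P.eval (inputWord e x) i
  | .sym σ => by
    simp only [BoolExpr.eval]
    exact tc0Map_sym e σ
  | .not P => by
    simp only [BoolExpr.eval]
    exact (P.tc0Map_eval e).map fun _ _ b => ¬ b
  | .and P₁ P₂ => by
    simp only [BoolExpr.eval]
    exact ((P₁.tc0Map_eval e).prodMk (P₂.tc0Map_eval e)).map fun _ _ b => b.1 ∧ b.2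
  | .pos φ _ => by
    simp only [BoolExpr.eval]
    exact (TC0Map.const ()).map fun _ i _ => φ i
  | .top => by
    simp only [BoolExpr.eval]
    exact .const _
  | .le C₁ C₂ => by
    simp only [BoolExpr.eval]
    exact ((C₁.tc0Map_eval e).prodMk (C₂.tc0Map_eval e)).map fun _ _ b => b.1 ≤ b.2

theorem CountExpr.tc0Map_eval (e : α ↪ Ξ) : ∀ C : CountExpr Ξ Φ Ψ,
    TC0Map fun n i (x : Fin n → α) => C.eval (inputWord e x) i
  | .count P => by
    simp only [CountExpr.eval]
    exact (P.tc0Map_eval e).count _ fun i => subset_rfl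
  | .countRel ψ _ P => by
    classical
    simp only [CountExpr.eval]
    have := (P.tc0Map_eval e).count (fun i => {j ∈ Finset.Icc 1 i | ψ i j})
      fun i => Finset.filter_subset _ _
    simpa only [Finset.filter_filter] using this
  | .cond P C₁ C₂ => by
    classical
    simp only [CountExpr.eval]
    exact ((P.tc0Map_eval e).prodMk ((C₁.tc0Map_eval e).prodMk (C₂.tc0Map_eval e))).map
      fun _ _ b => if b.1 then b.2.1 else b.2.2
  | .add C₁ C₂ => by
    simp only [CountExpr.eval]
    exact ((C₁.tc0Map_eval e).prodMk (C₂.tc0Map_eval e)).map fun _ _ b => b.1 + b.2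
  | .sub C₁ C₂ => by
    simp only [CountExpr.eval]
    exact ((C₁.tc0Map_eval e).prodMk (C₂.tc0Map_eval e)).map fun _ _ b => b.1 - b.2
  | .one => by
    simp only [CountExpr.eval]
    exact .const _

end

end Circuits

section Continuation

variable {α Ξ : Type*}

/-- The expression `P` has the same values on all proper continuations of the input words
`x` and `y`. -/
def BoolExpr.SameFuture {Φ : Set (ℕ → Prop)} {Ψ : Set (ℕ → ℕ → Prop)} (e : α ↪ Ξ)
    (P : BoolExpr Ξ Φ Ψ) (n : ℕ) (x y : Fin n → α) : Prop :=
  ∀ U : List Ξ, ∀ i, n < i → (P.eval (inputWord e x ++ U) i ↔ P.eval (inputWord e y ++ U) i)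

/-- The expression `C` has the same values on all proper continuations of the input words
`x` and `y`. -/
def CountExpr.SameFuture {Φ : Set (ℕ → Prop)} {Ψ : Set (ℕ → ℕ → Prop)} (e : α ↪ Ξ)
    (C : CountExpr Ξ Φ Ψ) (n : ℕ) (x y : Fin n → α) : Prop :=
  ∀ U : List Ξ, ∀ i, n < i → C.eval (inputWord e x ++ U) i = C.eval (inputWord e y ++ U) i

open Classical in
theorem card_filter_Icc_eq_of_split {p q : ℕ → Prop} {n i : ℕ} (h : n < i)
    (h₁ : {j ∈ Finset.Icc 1 n | p j}.card = {j ∈ Finset.Icc 1 n | q j}.card)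
    (h₂ : ∀ j, n < j → (p j ↔ q j)) :
    {j ∈ Finset.Icc 1 i | p j}.card = {j ∈ Finset.Icc 1 i | q j}.card := by
  have hd : Disjoint (Finset.Icc 1 n) (Finset.Ioc n i) :=
    Finset.disjoint_left.2 fun j hj hj' => by
      simp only [Finset.mem_Icc, Finset.mem_Ioc] at hj hj'
      omega
  have hu : Finset.Icc 1 i = Finset.Icc 1 n ∪ Finset.Ioc n i := by
    ext j
    simp only [Finset.mem_union, Finset.mem_Icc, Finset.mem_Ioc]
    omega
  rw [hu, Finset.filter_union, Finset.filter_union,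
    Finset.card_union_of_disjoint (Finset.disjoint_filter_filter hd),
    Finset.card_union_of_disjoint (Finset.disjoint_filter_filter hd), h₁,
    Finset.filter_congr fun j hj => h₂ j (Finset.mem_Ioc.1 hj).1]

mutual

theorem BoolExpr.hasTC0Invariant_sameFuture {Φ : Set (ℕ → Prop)} (e : α ↪ Ξ) :
    ∀ P : BoolExpr Ξ Φ localRels, HasTC0Invariant (P.SameFuture e)
  | .sym σ => .of_forall fun n x y U i hi => by
    simp only [BoolExpr.eval]
    rw [List.getElem?_append_right, List.getElem?_append_right] <;> simp <;> omega
  | .not P => (P.hasTC0Invariant_sameFuture e).mono fun n x y h U i hi => by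
    simp only [BoolExpr.eval, h U i hi]
  | .and P₁ P₂ =>
    ((P₁.hasTC0Invariant_sameFuture e).and (P₂.hasTC0Invariant_sameFuture e)).mono
      fun n x y h U i hi => by simp only [BoolExpr.eval, h.1 U i hi, h.2 U i hi]
  | .pos φ _ => .of_forall fun n x y U i hi => by simp only [BoolExpr.eval]
  | .top => .of_forall fun n x y U i hi => by simp only [BoolExpr.eval]
  | .le C₁ C₂ =>
    ((C₁.hasTC0Invariant_sameFuture e).and (C₂.hasTC0Invariant_sameFuture e)).mono
      fun n x y h U i hi => by simp only [BoolExpr.eval, h.1 U i hi, h.2 U i hi]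

theorem CountExpr.hasTC0Invariant_sameFuture {Φ : Set (ℕ → Prop)} (e : α ↪ Ξ) :
    ∀ C : CountExpr Ξ Φ localRels, HasTC0Invariant (C.SameFuture e)
  | .count P => by
    refine ((P.hasTC0Invariant_sameFuture e).and
      (.of_tc0Map ((CountExpr.count P).tc0Map_eval e))).mono fun n x y ⟨h, hn⟩ U i hi => ?_
    have hx := (CountExpr.count P).eval_append (inputWord e x) U (i := n) (by simp)
    have hy := (CountExpr.count P).eval_append (inputWord e y) U (i := n) (by simp)
    rw [← hx, ← hy] at hn
    simp only [CountExpr.eval, Nat.cast_inj] at hn ⊢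
    exact card_filter_Icc_eq_of_split hi hn (h U)
  | .countRel ψ hψ P => by
    classical
    obtain ⟨τ, hτ⟩ := hψ.2
    refine ((P.hasTC0Invariant_sameFuture e).and (.of_tc0Map (.pi fun k : Fin (τ + 1) =>
      (P.tc0Map_eval e).reindex (fun n _ => n - k) fun n _ => Nat.sub_le _ _))).mono
      fun n x y ⟨h, hn⟩ U i hi => ?_
    simp only [CountExpr.eval]
    congr 2
    refine Finset.filter_congr fun j hj => and_congr_right fun hij => ?_
    rcases lt_or_ge n j with hj' | hj'
    · exact h U j hj'
    · rw [P.eval_append _ U (by simpa using hj'), P.eval_append _ U (by simpa using hj')]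
      have := congrFun hn ⟨n - j, by have := hτ i j hij; omega⟩
      simpa [Nat.sub_sub_self hj'] using this
  | .cond P C₁ C₂ =>
    ((P.hasTC0Invariant_sameFuture e).and
      ((C₁.hasTC0Invariant_sameFuture e).and (C₂.hasTC0Invariant_sameFuture e))).mono
      fun n x y h U i hi => by
        simp only [CountExpr.eval, h.2.1 U i hi, h.2.2 U i hi]
        classical
        exact if_congr (h.1 U i hi) rfl rfl
  | .add C₁ C₂ =>
    ((C₁.hasTC0Invariant_sameFuture e).and (C₂.hasTC0Invariant_sameFuture e)).mono
      fun n x y h U i hi => by simp only [CountExpr.eval, h.1 U i hi, h.2 U i hi]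
  | .sub C₁ C₂ =>
    ((C₁.hasTC0Invariant_sameFuture e).and (C₂.hasTC0Invariant_sameFuture e)).mono
      fun n x y h U i hi => by simp only [CountExpr.eval, h.1 U i hi, h.2 U i hi]
  | .one => .of_forall fun n x y U i hi => by simp only [CountExpr.eval]

end

theorem CoTProgram.nextToken_congr (P : CoTProgram Ξ) {w w' : List Ξ}
    (h : ∀ σ, (P.out σ).eval w w.length ↔ (P.out σ).eval w' w'.length) :
    P.nextToken w = P.nextToken w' :=
  (P.exactly_one w').unique ((h _).1 (P.exactly_one w).choose_spec.1)
    (P.exactly_one w').choose_spec.1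

/-- The behaviour of a CoT program on an input word depends only on an invariant of the word that
is computed in TC⁰. -/
theorem CoTProgram.hasTC0Invariant_nextToken [Finite Ξ] (P : CoTProgram Ξ) (e : α ↪ Ξ) :
    HasTC0Invariant fun n (x y : Fin n → α) =>
      ∀ U, P.nextToken (inputWord e x ++ U) = P.nextToken (inputWord e y ++ U) := by
  refine (HasTC0Invariant.all_finite fun σ => ((P.out σ).hasTC0Invariant_sameFuture e).and
    (.of_tc0Map ((P.out σ).tc0Map_eval e))).mono fun n x y h U => ?_
  refine P.nextToken_congr fun σ => ?_
  rcases eq_or_ne U [] with rfl | hU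
  · simpa using (h σ).2
  · have := (h σ).1 U (n + U.length) (by simpa using List.length_pos_iff.2 hU)
    simpa using this

end Continuation

section Generation

variable {Ξ : Type*} {M : List Ξ → Ξ}

theorem Generates.congr {w w' U : List Ξ} (h : Generates M w U)
    (hM : ∀ V, M (w ++ V) = M (w' ++ V)) : Generates M w' U :=
  fun k hk => (hM _).symm.trans (h k hk)

theorem Generates.take_eq {w U V : List Ξ} (hU : Generates M w U) (hV : Generates M w V) {k : ℕ}
    (hkU : k ≤ U.length) (hkV : k ≤ V.length) : U.take k = V.take k := by
  induction k with
  | zero => simp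
  | succ k ih =>
    rw [List.take_succ_eq_append_getElem (by omega), List.take_succ_eq_append_getElem (by omega),
      ih (by omega) (by omega), ← hU k (by omega), ← hV k (by omega), ih (by omega) (by omega)]

/-- The string generated up to the first occurrence of a token is unique. -/
theorem Generates.unique {w U V : List Ξ} {a : Ξ} (hU : Generates M w (U ++ [a]))
    (hV : Generates M w (V ++ [a])) (haU : a ∉ U) (haV : a ∉ V) : U = V := by
  wlog hle : U.length ≤ V.length generalizing U V
  · exact (this hV hU haV haU (by omega)).symm
  have h := hU.take_eq hV (k := U.length + 1) (by simp) (by simpa using hle)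
  rcases hle.eq_or_lt with heq | hlt
  · rw [List.take_of_length_le (by simp), List.take_of_length_le (by simp [heq])] at h
    exact List.append_cancel_right h
  · rw [List.take_of_length_le (by simp), List.take_append_of_le_length (by omega)] at h
    exact absurd (List.mem_of_mem_take (h ▸ by simp : a ∈ V.take (U.length + 1))) haV

end Generation

theorem theorem1 {α Ξ : Type*} [Finite α] [Finite Ξ] (A : CoTAlphabet α Ξ)
    (one zero : Ξ) (h_ne : one ≠ zero)
    (h_one : one ≠ A.sep ∧ one ≠ A.eos) (h_zero : zero ≠ A.sep ∧ zero ≠ A.eos)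
    (L : Language α) (P : CoTProgram Ξ)
    (hP : ComputesWithCoT A P.nextToken (indicatorFun L one zero)) :
    InTC0 L := by
  refine ((P.hasTC0Invariant_nextToken A.emb).mono fun n x y h hx => ?_).inTC0
  by_contra hy
  obtain ⟨T, hT, hTg⟩ := (hP (List.ofFn x)).1 [one] (by simp [indicatorFun, hx])
  obtain ⟨T', hT', hTg'⟩ := (hP (List.ofFn y)).1 [zero] (by simp [indicatorFun, hy])
  have := (hTg.congr h).unique hTg' hT hT'
  exact h_ne (by simpa using congrArg List.getLast? this)
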